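/- Let $X$ be a complex Banach space and let $T$ be a bounded linear operator on $X$. For a closed subspace $L\subseteq X$ with $T(L)\subseteq L$, let $T_L\colon L\to L$ denote the restriction of $T$. For a bounded operator $S$ on a complex Banach space, let $\alpha(S)\in\{0,1,2,\dots\}\cup\{\infty\}$ be the dimension of its kernel and $\beta(S)\in\{0,1,2,\dots\}\cup\{\infty\}$ the codimension of its range. The operator $S$ is called semi-Fredholm if its range is closed and at least one of $\alpha(S),\beta(S)$ is finite, and its index is then $\operatorname{ind}(S)=\alpha(S)-\beta(S)\in\mathbb{Z}\cup\{-\infty,\infty\}$. The operator $S$ is called zeroloid if the spectrum $\sigma(S)$ has no accumulation point other than $0$. Let $(M,N)$ and $(M',N')$ be two pairs of closed $T$-invariant subspaces of $X$ such that $M\cap N=\{0\}$, $M'\cap N'=\{0\}$, and $M\oplus N=M'\oplus N'$ is a closed subspace of $X$. If $T_M$ and $T_{M'}$ are semi-Fredholm and $T_N$ and $T_{N'}$ are zeroloid, then $\operatorname{ind}(T_M)=\operatorname{ind}(T_{M'})$. -/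

import Mathlib

namespace GzFredholm

variable {X : Type*} [NormedAddCommGroup X] [NormedSpace ℂ X]

/-- `α(T)`: the dimension of the kernel of `T`, a natural number or `∞`. -/
noncomputable def alpha (T : X →L[ℂ] X) : ℕ∞ :=
  Cardinal.toENat (Module.rank ℂ (T : X →ₗ[ℂ] X).ker)

/-- `β(T)`: the codimension of the range of `T`, a natural number or `∞`. -/
noncomputable def beta (T : X →L[ℂ] X) : ℕ∞ :=
  Cardinal.toENat (Module.rank ℂ (X ⧸ (T : X →ₗ[ℂ] X).range))

/-- `T` is upper semi-Fredholm: its range is closed and its kernel is finite dimensional. -/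
def IsUpperSemiFredholm (T : X →L[ℂ] X) : Prop :=
  IsClosed (Set.range T) ∧ alpha T < ⊤

/-- `T` is lower semi-Fredholm: its range is closed and has finite codimension. (On a Banach space
a range of finite codimension is automatically closed.) -/
def IsLowerSemiFredholm (T : X →L[ℂ] X) : Prop :=
  IsClosed (Set.range T) ∧ beta T < ⊤

/-- `T` is semi-Fredholm: it is upper or lower semi-Fredholm. -/
def IsSemiFredholm (T : X →L[ℂ] X) : Prop :=
  IsUpperSemiFredholm T ∨ IsLowerSemiFredholm T

/-- The index `ind(T) = α(T) - β(T)` as an element of `ℤ ∪ {-∞, ∞}`, seen inside the extended real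
numbers. It is meant for semi-Fredholm `T`, for which `α(T)` and `β(T)` are not both infinite. -/
noncomputable def index (T : X →L[ℂ] X) : EReal :=
  ((alpha T : ENNReal) : EReal) - ((beta T : ENNReal) : EReal)

/-- `T` is zeroloid: the spectrum of `T` has no accumulation point other than `0`. -/
def IsZeroloid (T : X →L[ℂ] X) : Prop :=
  derivedSet (spectrum ℂ T) ⊆ {0}

end GzFredholm

/-!
Arbitrarily close to `0` there are points `z` at which both `T_N - z` and `T_{N'} - z` are
invertible. For such `z` the operators `T_M - z` and `T_{M'} - z` both have the nullity and the
deficiency of `T - z` on `M ⊕ N = M' ⊕ N'`, so it suffices that the index of a semi-Fredholm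
operator does not change under small perturbations.

Among surjective operators the nullity is a continuous `ℕ∞`-valued function, and so is the
deficiency among injective operators with closed range; both are therefore constant on small balls,
which are connected. A semi-Fredholm operator becomes injective with closed range after restriction
to a closed subspace of finite codimension, or surjective after passing to a quotient by a
finite-dimensional subspace, and the index formula for compositions transfers the local constancy.
-/

open Filter Topology

namespace GzFredholm

section LinearAlgebra

variable {R U V W U' V' W' : Type*} [Ring R] [AddCommGroup U'] [Module R U'] [AddCommGroup V']
  [Module R V'] [AddCommGroup W'] [Module R W'] [AddCommGroup U] [Module R U] [AddCommGroup V]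
  [Module R V] [AddCommGroup W] [Module R W]

/-- The nullity of a linear map: the length (over a field, the dimension) of its kernel. -/
noncomputable def nullity (f : V →ₗ[R] W) : ℕ∞ :=
  Module.length R f.ker

/-- The deficiency of a linear map: the length (over a field, the dimension) of its cokernel. -/
noncomputable def deficiency (f : V →ₗ[R] W) : ℕ∞ :=
  Module.length R (W ⧸ f.range)

theorem nullity_eq_zero_iff {f : V →ₗ[R] W} : nullity f = 0 ↔ Function.Injective f := by
  rw [nullity, Module.length_eq_zero_iff, Submodule.subsingleton_iff_eq_bot,
    LinearMap.ker_eq_bot]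

theorem deficiency_eq_zero_iff {f : V →ₗ[R] W} : deficiency f = 0 ↔ Function.Surjective f := by
  rw [deficiency, Module.length_eq_zero_iff, Submodule.Quotient.subsingleton_iff,
    LinearMap.range_eq_top]

theorem deficiency_subtype (P : Submodule R V) :
    deficiency P.subtype = Module.length R (V ⧸ P) := by
  rw [deficiency, P.range_subtype]

theorem length_eq_length_range_add_length_range {f : U →ₗ[R] V} {g : V →ₗ[R] W}
    (h : Function.Exact f g) :
    Module.length R V = Module.length R f.range + Module.length R g.range := by
  rw [← h.linearMap_ker_eq]
  exact Module.length_eq_add_of_exact g.ker.subtype g.rangeRestrict g.ker.injective_subtype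
    g.surjective_rangeRestrict (LinearMap.exact_iff.2 (by simp))

theorem length_range_of_injective {f : U →ₗ[R] V} (hf : Function.Injective f) :
    Module.length R f.range = Module.length R U :=
  (LinearEquiv.ofInjective f hf).length_eq.symm

theorem length_range_of_surjective {f : U →ₗ[R] V} (hf : Function.Surjective f) :
    Module.length R f.range = Module.length R V := by
  rw [LinearMap.range_eq_top.2 hf, Module.length_top]

theorem nullity_eq_length_of_exact {f : U →ₗ[R] V} {g : V →ₗ[R] W} (h : Function.Exact f g)
    (hf : Function.Injective f) : nullity g = Module.length R U := by
  rw [nullity, h.linearMap_ker_eq, length_range_of_injective hf]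

theorem deficiency_eq_length_of_exact {f : U →ₗ[R] V} {g : V →ₗ[R] W} (h : Function.Exact f g)
    (hg : Function.Surjective g) : deficiency f = Module.length R W := by
  rw [deficiency, ← h.linearMap_ker_eq]
  exact (g.quotKerEquivOfSurjective hg).length_eq

/-- The lengths `a`, `b`, `c` are those of the images of the three middle maps of the exact sequence
`0 → ker f → ker (g ∘ f) → ker g → coker f → coker (g ∘ f) → coker g → 0`. -/
theorem exists_nullity_deficiency_comp (g : V →ₗ[R] W) (f : U →ₗ[R] V) :
    ∃ a b c : ℕ∞, nullity (g ∘ₗ f) = nullity f + a ∧ nullity g = a + b ∧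
      deficiency f = b + c ∧ deficiency (g ∘ₗ f) = c + deficiency g := by
  let ι : f.ker →ₗ[R] (g ∘ₗ f).ker := Submodule.inclusion (LinearMap.ker_le_ker_comp f g)
  let φ : (g ∘ₗ f).ker →ₗ[R] g.ker := f.restrict fun _ hx => hx
  let δ : g.ker →ₗ[R] V ⧸ f.range := f.range.mkQ ∘ₗ g.ker.subtype
  let γ : V ⧸ f.range →ₗ[R] W ⧸ (g ∘ₗ f).range :=
    f.range.mapQ _ g (by rintro _ ⟨x, rfl⟩; exact ⟨x, rfl⟩)
  let π : W ⧸ (g ∘ₗ f).range →ₗ[R] W ⧸ g.range :=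
    Submodule.factor (LinearMap.range_comp_le_range f g)
  have exact_ι_φ : Function.Exact ι φ := by
    rintro ⟨x, hx⟩
    refine ⟨fun h => ⟨⟨x, congrArg Subtype.val h⟩, rfl⟩, ?_⟩
    rintro ⟨y, h⟩
    exact h ▸ Subtype.ext y.2
  have exact_φ_δ : Function.Exact φ δ := by
    rintro ⟨y, hy⟩
    refine ⟨fun h => ?_, ?_⟩
    · obtain ⟨x, rfl⟩ := (Submodule.Quotient.mk_eq_zero _).1 h
      exact ⟨⟨x, hy⟩, rfl⟩
    · rintro ⟨x, hx⟩
      exact (Submodule.Quotient.mk_eq_zero _).2 ⟨x, congrArg Subtype.val hx⟩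
  have exact_δ_γ : Function.Exact δ γ := by
    rw [LinearMap.exact_iff, Submodule.ker_mapQ, LinearMap.range_comp, Submodule.comap_map_eq,
      Submodule.map_sup, Submodule.mkQ_map_self, bot_sup_eq, LinearMap.range_comp,
      Submodule.range_subtype]
  have exact_γ_π : Function.Exact γ π := by
    rw [LinearMap.exact_iff, Submodule.range_mapQ, Submodule.ker_mapQ, Submodule.comap_id]
  refine ⟨Module.length R φ.range, Module.length R δ.range, Module.length R γ.range, ?_, ?_, ?_, ?_⟩
  · rw [nullity, length_eq_length_range_add_length_range exact_ι_φ,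
      length_range_of_injective (Submodule.inclusion_injective _), nullity]
  · exact length_eq_length_range_add_length_range exact_φ_δ
  · exact length_eq_length_range_add_length_range exact_δ_γ
  · rw [deficiency, length_eq_length_range_add_length_range exact_γ_π,
      length_range_of_surjective (Submodule.factor_surjective _), deficiency]

theorem index_comp (g : V →ₗ[R] W) (f : U →ₗ[R] V) :
    nullity f + nullity g + deficiency (g ∘ₗ f) =
      nullity (g ∘ₗ f) + deficiency f + deficiency g := by
  obtain ⟨a, b, c, h₁, h₂, h₃, h₄⟩ := exists_nullity_deficiency_comp g f
  rw [h₁, h₂, h₃, h₄]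
  ring

theorem nullity_le_nullity_comp_add_deficiency (g : V →ₗ[R] W) (f : U →ₗ[R] V) :
    nullity g ≤ nullity (g ∘ₗ f) + deficiency f := by
  obtain ⟨a, b, c, h₁, h₂, h₃, -⟩ := exists_nullity_deficiency_comp g f
  rw [h₁, h₂, h₃]
  exact add_le_add le_add_self le_self_add

theorem deficiency_le_deficiency_comp_add_nullity (g : V →ₗ[R] W) (f : U →ₗ[R] V) :
    deficiency f ≤ deficiency (g ∘ₗ f) + nullity g := by
  obtain ⟨a, b, c, -, h₂, h₃, h₄⟩ := exists_nullity_deficiency_comp g f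
  rw [h₂, h₃, h₄, add_comm]
  exact add_le_add le_self_add le_add_self

theorem nullity_prodMap_of_injective (f : V →ₗ[R] W) {g : V' →ₗ[R] W'}
    (hg : Function.Injective g) : nullity (f.prodMap g) = nullity f := by
  rw [nullity, LinearMap.ker_prodMap, LinearMap.ker_eq_bot.2 hg, ← Submodule.map_inl, nullity]
  exact (Submodule.equivMapOfInjective _ LinearMap.inl_injective f.ker).length_eq.symm

theorem deficiency_prodMap_of_surjective (f : V →ₗ[R] W) {g : V' →ₗ[R] W'}
    (hg : Function.Surjective g) : deficiency (f.prodMap g) = deficiency f := by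
  refine deficiency_eq_length_of_exact (g := f.range.mkQ ∘ₗ LinearMap.fst R W W') ?_
    (f.range.mkQ_surjective.comp LinearMap.fst_surjective)
  rw [LinearMap.exact_iff, LinearMap.ker_comp, Submodule.ker_mkQ, Submodule.comap_fst,
    LinearMap.range_prodMap, LinearMap.range_eq_top.2 hg]

theorem nullity_eq_of_comp_eq {f : U →ₗ[R] V} {g : U' →ₗ[R] V'} (e : U ≃ₗ[R] U') (e' : V ≃ₗ[R] V')
    (h : e'.toLinearMap ∘ₗ f = g ∘ₗ e.toLinearMap) : nullity f = nullity g := by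
  have hker : f.ker = g.ker.comap e.toLinearMap := by
    rw [← LinearMap.ker_comp, ← h, e'.ker_comp]
  rw [nullity, hker]
  exact (e.ofSubmodule' g.ker).length_eq

theorem deficiency_eq_of_comp_eq {f : U →ₗ[R] V} {g : U' →ₗ[R] V'} (e : U ≃ₗ[R] U')
    (e' : V ≃ₗ[R] V') (h : e'.toLinearMap ∘ₗ f = g ∘ₗ e.toLinearMap) :
    deficiency f = deficiency g := by
  refine (Submodule.Quotient.equiv _ _ e' ?_).length_eq
  rw [← LinearMap.range_comp, h, e.range_comp]

theorem exists_linearEquiv_comp_prodMap_restrict {f : V →ₗ[R] V} {M N S : Submodule R V}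
    (hM : ∀ x ∈ M, f x ∈ M) (hN : ∀ x ∈ N, f x ∈ N) (hS : ∀ x ∈ S, f x ∈ S)
    (hdisj : Disjoint M N) (hsup : M ⊔ N = S) :
    ∃ e : (M × N) ≃ₗ[R] S, e.toLinearMap ∘ₗ (f.restrict hM).prodMap (f.restrict hN) =
      f.restrict hS ∘ₗ e.toLinearMap := by
  have hinj : Function.Injective (M.subtype.coprod N.subtype) := by
    rw [← LinearMap.ker_eq_bot, LinearMap.ker_coprod_of_disjoint_range _ _ (by simpa using hdisj),
      M.ker_subtype, N.ker_subtype, Submodule.prod_bot]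
  have hrange : (M.subtype.coprod N.subtype).range = S := by
    rw [← Submodule.sup_eq_range, hsup]
  refine ⟨.ofInjective _ hinj ≪≫ₗ .ofEq _ _ hrange, LinearMap.ext fun x => Subtype.ext ?_⟩
  exact (map_add f (x.1 : V) x.2).symm

theorem nullity_restrict_eq_of_sup_eq {f : V →ₗ[R] V} {M N S : Submodule R V}
    (hM : ∀ x ∈ M, f x ∈ M) (hN : ∀ x ∈ N, f x ∈ N) (hS : ∀ x ∈ S, f x ∈ S)
    (hdisj : Disjoint M N) (hsup : M ⊔ N = S) (hinj : Function.Injective (f.restrict hN)) :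
    nullity (f.restrict hM) = nullity (f.restrict hS) := by
  obtain ⟨e, he⟩ := exists_linearEquiv_comp_prodMap_restrict hM hN hS hdisj hsup
  rw [← nullity_prodMap_of_injective _ hinj, nullity_eq_of_comp_eq e e he]

theorem deficiency_restrict_eq_of_sup_eq {f : V →ₗ[R] V} {M N S : Submodule R V}
    (hM : ∀ x ∈ M, f x ∈ M) (hN : ∀ x ∈ N, f x ∈ N) (hS : ∀ x ∈ S, f x ∈ S)
    (hdisj : Disjoint M N) (hsup : M ⊔ N = S) (hsurj : Function.Surjective (f.restrict hN)) :
    deficiency (f.restrict hM) = deficiency (f.restrict hS) := by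
  obtain ⟨e, he⟩ := exists_linearEquiv_comp_prodMap_restrict hM hN hS hdisj hsup
  rw [← deficiency_prodMap_of_surjective _ hsurj, deficiency_eq_of_comp_eq e e he]

end LinearAlgebra

theorem exists_le_length_eq {K V : Type*} [DivisionRing K] [AddCommGroup V] [Module K V]
    (U : Submodule K V) {n : ℕ} (hn : n ≤ Module.length K U) :
    ∃ F ≤ U, FiniteDimensional K F ∧ Module.length K F = n := by
  rw [Module.length_eq_rank, Cardinal.natCast_le_toENat, Module.le_rank_iff_exists_linearMap] at hn
  obtain ⟨f, hf⟩ := hn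
  have hinj : Function.Injective (U.subtype ∘ₗ f) := U.injective_subtype.comp hf
  refine ⟨(U.subtype ∘ₗ f).range, ?_, inferInstance, ?_⟩
  · rw [LinearMap.range_comp]
    exact U.map_subtype_le _
  · rw [length_range_of_injective hinj, Module.length_eq_finrank, Module.finrank_fin_fun]

section LocalConstancy

variable {H β : Type*} [NormedAddCommGroup H] [NormedSpace ℝ H]

theorem eventually_eq_of_eventually_continuousAt [TopologicalSpace β] [TotallyDisconnectedSpace β]
    {φ : H → β} {x : H} (h : ∀ᶠ y in 𝓝 x, ContinuousAt φ y) : ∀ᶠ y in 𝓝 x, φ y = φ x := by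
  obtain ⟨r, hr, hball⟩ := Metric.eventually_nhds_iff_ball.1 h
  have himage : (φ '' Metric.ball x r).Subsingleton :=
    ((convex_ball x r).isPreconnected.image φ
      fun y hy => (hball y hy).continuousWithinAt).subsingleton
  filter_upwards [Metric.ball_mem_nhds x hr] with y hy
  exact himage (Set.mem_image_of_mem φ hy) (Set.mem_image_of_mem φ (Metric.mem_ball_self hr))

theorem continuousAt_enat_of_eventually_le {α : Type*} [TopologicalSpace α] {φ : α → ℕ∞} {x : α}
    (hlower : ∀ n : ℕ, n ≤ φ x → ∀ᶠ y in 𝓝 x, n ≤ φ y)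
    (hupper : φ x < ⊤ → ∀ᶠ y in 𝓝 x, φ y ≤ φ x) : ContinuousAt φ x := by
  rw [ContinuousAt]
  cases hx : φ x with
  | top =>
    rw [hx] at hlower
    rw [ENat.tendsto_nhds_top_iff_natCast_lt]
    intro n
    filter_upwards [hlower (n + 1) le_top] with y hy
    exact (ENat.natCast_lt_natCast.2 n.lt_succ_self).trans_le hy
  | coe n =>
    rw [hx] at hlower hupper
    rw [ENat.nhds_eq_pure (ENat.natCast_ne_top n), tendsto_pure]
    filter_upwards [hlower n le_rfl, hupper (ENat.natCast_lt_top n)] with y hlo hup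
    exact hup.antisymm hlo

end LocalConstancy

section Perturbation

variable {𝕜 E G : Type*} [RCLike 𝕜] [NormedAddCommGroup E] [NormedSpace 𝕜 E]
  [NormedAddCommGroup G] [NormedSpace 𝕜 G]

theorem exists_injective_comp_subtypeL {A : E →L[𝕜] G} (hc : IsClosed (Set.range A))
    (hfin : nullity A.toLinearMap < ⊤) :
    ∃ L : Submodule 𝕜 E, IsClosed (L : Set E) ∧ deficiency L.subtype = nullity A.toLinearMap ∧
      Function.Injective (A ∘L L.subtypeL) ∧ IsClosed (Set.range (A ∘L L.subtypeL)) := by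
  have : FiniteDimensional 𝕜 A.ker := by
    rwa [nullity, Module.length_eq_rank, Cardinal.toENat_lt_top, Module.rank_lt_aleph0_iff] at hfin
  obtain ⟨L, hL, hcompl⟩ :=
    (Submodule.ClosedComplemented.of_finiteDimensional A.ker).exists_isClosed_isCompl
  refine ⟨L, hL, ?_, ?_, ?_⟩
  · rw [deficiency_subtype]
    exact (Submodule.quotientEquivOfIsCompl _ _ hcompl.symm).length_eq
  · exact LinearMap.injective_domRestrict_iff.2 hcompl.disjoint.symm
  · have hrange : (A.toLinearMap ∘ₗ L.subtype).range = A.range := by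
      rw [LinearMap.range_comp, L.range_subtype,
        Submodule.map_eq_range_iff.2 hcompl.codisjoint.symm]
    have hclosed : IsClosed ((A.toLinearMap ∘ₗ L.subtype).range : Set G) := by
      rw [hrange]
      exact hc
    exact hclosed

theorem exists_surjective_mkQL_comp {A : E →L[𝕜] G} (hfin : deficiency A.toLinearMap < ⊤) :
    ∃ F : Submodule 𝕜 G, IsClosed (F : Set G) ∧ nullity F.mkQ = deficiency A.toLinearMap ∧
      Function.Surjective (F.mkQL ∘L A) := by
  obtain ⟨F, hcompl⟩ := A.range.exists_isCompl
  have hlength : deficiency A.toLinearMap = Module.length 𝕜 F :=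
    (Submodule.quotientEquivOfIsCompl _ _ hcompl).length_eq
  have : FiniteDimensional 𝕜 F := by
    rwa [hlength, Module.length_eq_rank, Cardinal.toENat_lt_top, Module.rank_lt_aleph0_iff] at hfin
  refine ⟨F, F.closed_of_finiteDimensional, ?_, ?_⟩
  · rw [nullity, F.ker_mkQ, hlength]
  · have hrange : (F.mkQ ∘ₗ A.toLinearMap).range = ⊤ := by
      rw [LinearMap.range_comp, Submodule.map_mkQ_eq_top, hcompl.symm.sup_eq_top]
    exact LinearMap.range_eq_top.1 hrange

variable [CompleteSpace E] [CompleteSpace G]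

theorem eventually_injective_isClosed_range {A : E →L[𝕜] G} (hA : Function.Injective A)
    (hc : IsClosed (Set.range A)) :
    ∀ᶠ B : E →L[𝕜] G in 𝓝 A, Function.Injective B ∧ IsClosed (Set.range B) := by
  obtain ⟨c, hc⟩ := A.antilipschitz_of_injective_of_isClosed_range hA hc
  have hanti : AntilipschitzWith (c + 1) A := fun x y => (hc x y).trans (by gcongr; simp)
  have hpos : 0 < c + 1 := by positivity
  filter_upwards [Metric.ball_mem_nhds A (inv_pos.2 (NNReal.coe_pos.2 hpos))] with B hB
  have hlt : ‖B - A‖₊ < (c + 1)⁻¹ := by simpa [← NNReal.coe_lt_coe, dist_eq_norm] using hB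
  have hantiB : AntilipschitzWith ((c + 1)⁻¹ - ‖B - A‖₊)⁻¹ B := by
    simpa using hanti.add_lipschitzWith (B - A).lipschitz hlt
  exact ⟨hantiB.injective, hantiB.isClosed_range B.uniformContinuous⟩

theorem eventually_surjective {A : E →L[𝕜] G} (hA : Function.Surjective A) :
    ∀ᶠ B : E →L[𝕜] G in 𝓝 A, Function.Surjective B := by
  have hrange : A.range = ⊤ := LinearMap.range_eq_top.2 hA
  let σ := A.nonlinearRightInverseOfSurjective hrange
  have hσ : 0 < σ.nnnorm := A.nonlinearRightInverseOfSurjective_nnnorm_pos hrange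
  filter_upwards [Metric.ball_mem_nhds A (inv_pos.2 (NNReal.coe_pos.2 hσ))] with B hB
  have hlt : ‖B - A‖₊ < σ.nnnorm⁻¹ := by simpa [← NNReal.coe_lt_coe, dist_eq_norm] using hB
  have happrox : ApproximatesLinearOn B A Set.univ ‖B - A‖₊ := fun x _ y _ => by
    simpa using (B - A).le_opNorm (x - y)
  have hnhds := happrox.image_mem_nhds σ (x := 0) univ_mem (Or.inr hlt)
  rw [Set.image_univ, map_zero] at hnhds
  exact LinearMap.range_eq_top.1 <|
    B.range.eq_top_of_nonempty_interior' ⟨0, mem_interior_iff_mem_nhds.2 hnhds⟩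

theorem eventually_nullity_le {A : E →L[𝕜] G} (hc : IsClosed (Set.range A))
    (hfin : nullity A.toLinearMap < ⊤) :
    ∀ᶠ B : E →L[𝕜] G in 𝓝 A, nullity B.toLinearMap ≤ nullity A.toLinearMap := by
  obtain ⟨L, hL, hdef, hinj, hrange⟩ := exists_injective_comp_subtypeL hc hfin
  have := hL.completeSpace_coe
  have hcont : Continuous fun B : E →L[𝕜] G => B ∘L L.subtypeL := by fun_prop
  filter_upwards [hcont.tendsto A (eventually_injective_isClosed_range hinj hrange)] with B hB
  have hcomp := nullity_le_nullity_comp_add_deficiency B.toLinearMap L.subtype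
  have hzero : nullity (B.toLinearMap ∘ₗ L.subtype) = 0 := nullity_eq_zero_iff.2 hB.1
  rwa [hzero, zero_add, hdef] at hcomp

theorem eventually_deficiency_le {A : E →L[𝕜] G} (hfin : deficiency A.toLinearMap < ⊤) :
    ∀ᶠ B : E →L[𝕜] G in 𝓝 A, deficiency B.toLinearMap ≤ deficiency A.toLinearMap := by
  obtain ⟨F, hF, hnull, hsurj⟩ := exists_surjective_mkQL_comp hfin
  have hcont : Continuous fun B : E →L[𝕜] G => F.mkQL ∘L B := by fun_prop
  filter_upwards [hcont.tendsto A (eventually_surjective hsurj)] with B hB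
  have hcomp := deficiency_le_deficiency_comp_add_nullity F.mkQ B.toLinearMap
  have hzero : deficiency (F.mkQ ∘ₗ B.toLinearMap) = 0 := deficiency_eq_zero_iff.2 hB
  rwa [hzero, zero_add, hnull] at hcomp

theorem eventually_le_deficiency {A : E →L[𝕜] G} (hA : Function.Injective A)
    (hc : IsClosed (Set.range A)) {n : ℕ} (hn : n ≤ deficiency A.toLinearMap) :
    ∀ᶠ B : E →L[𝕜] G in 𝓝 A, n ≤ deficiency B.toLinearMap := by
  obtain ⟨C, hC⟩ := A.range.exists_isCompl
  have hlength : deficiency A.toLinearMap = Module.length 𝕜 C :=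
    (Submodule.quotientEquivOfIsCompl _ _ hC).length_eq
  obtain ⟨F, hFC, hF, hn⟩ := exists_le_length_eq C (hn.trans hlength.le)
  have := FiniteDimensional.complete 𝕜 F
  -- Injectivity of `(x, v) ↦ B x + v` forces the codimension of the range of `B` to be at least
  -- `dim F`.
  have hinj : Function.Injective (A.coprod F.subtypeL) := by
    have hdisj : Disjoint A.range F.subtype.range := by
      rw [F.range_subtype]
      exact hC.disjoint.mono_right hFC
    have hker : (A.toLinearMap.coprod F.subtype).ker = ⊥ := by
      rw [LinearMap.ker_coprod_of_disjoint_range _ _ hdisj, LinearMap.ker_eq_bot.2 hA,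
        F.ker_subtype, Submodule.prod_bot]
    exact LinearMap.ker_eq_bot.1 hker
  have hrange : IsClosed (Set.range (A.coprod F.subtypeL)) := by
    have hsup : (A.toLinearMap.coprod F.subtype).range = A.range ⊔ F := by
      rw [LinearMap.range_coprod, F.range_subtype]
    have : IsClosed ((A.range ⊔ F : Submodule 𝕜 G) : Set G) :=
      Submodule.isClosed_sup_finiteDimensional _ _ hc
    rwa [← hsup] at this
  have hcont : Continuous fun B : E →L[𝕜] G => B.coprod F.subtypeL := by fun_prop
  filter_upwards [hcont.tendsto A (eventually_injective_isClosed_range hinj hrange)] with B hB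
  have hcomp := deficiency_le_deficiency_comp_add_nullity (B.toLinearMap.coprod F.subtype)
    (LinearMap.inl 𝕜 E F)
  have hzero : nullity (B.toLinearMap.coprod F.subtype) = 0 := nullity_eq_zero_iff.2 hB.1
  rwa [hzero, add_zero, LinearMap.coprod_inl, deficiency_eq_length_of_exact
    Function.Exact.inl_snd LinearMap.snd_surjective, hn] at hcomp

theorem eventually_le_nullity {A : E →L[𝕜] G} (hA : Function.Surjective A) {n : ℕ}
    (hn : n ≤ nullity A.toLinearMap) :
    ∀ᶠ B : E →L[𝕜] G in 𝓝 A, n ≤ nullity B.toLinearMap := by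
  obtain ⟨K, hK, hfin, hn⟩ := exists_le_length_eq A.ker hn
  have := FiniteDimensional.complete 𝕜 K
  obtain ⟨P, hP⟩ := Submodule.ClosedComplemented.of_finiteDimensional K
  -- Surjectivity of `x ↦ (B x, P x)` forces the kernel of `B` to have dimension at least `dim K`.
  have hsurj : Function.Surjective (A.prod P) := by
    rintro ⟨y, k⟩
    obtain ⟨x, rfl⟩ := hA y
    have hker : ∀ w : K, A w = 0 := fun w => hK w.2
    exact ⟨x - P x + k, by simp [hker, hP]⟩
  have hcont : Continuous fun B : E →L[𝕜] G => B.prod P :=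
    (ContinuousLinearMap.prodL 𝕜).continuous.comp (.prodMk_left P)
  filter_upwards [hcont.tendsto A (eventually_surjective hsurj)] with B hB
  have hcomp := nullity_le_nullity_comp_add_deficiency (LinearMap.fst 𝕜 G K)
    (B.toLinearMap.prod P.toLinearMap)
  have hzero : deficiency (B.toLinearMap.prod P.toLinearMap) = 0 := deficiency_eq_zero_iff.2 hB
  rwa [hzero, add_zero, LinearMap.fst_prod, nullity_eq_length_of_exact
    Function.Exact.inr_fst LinearMap.inr_injective, hn] at hcomp

theorem eventually_deficiency_eq {A : E →L[𝕜] G} (hA : Function.Injective A)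
    (hc : IsClosed (Set.range A)) :
    ∀ᶠ B : E →L[𝕜] G in 𝓝 A, deficiency B.toLinearMap = deficiency A.toLinearMap := by
  let _ : NormedSpace ℝ (E →L[𝕜] G) := NormedSpace.restrictScalars ℝ 𝕜 _
  refine eventually_eq_of_eventually_continuousAt
    (φ := fun B : E →L[𝕜] G => deficiency B.toLinearMap) ?_
  filter_upwards [eventually_injective_isClosed_range hA hc] with B ⟨hB, hcB⟩
  exact continuousAt_enat_of_eventually_le (fun n => eventually_le_deficiency hB hcB)
    eventually_deficiency_le

theorem eventually_nullity_eq {A : E →L[𝕜] G} (hA : Function.Surjective A) :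
    ∀ᶠ B : E →L[𝕜] G in 𝓝 A, nullity B.toLinearMap = nullity A.toLinearMap := by
  let _ : NormedSpace ℝ (E →L[𝕜] G) := NormedSpace.restrictScalars ℝ 𝕜 _
  refine eventually_eq_of_eventually_continuousAt
    (φ := fun B : E →L[𝕜] G => nullity B.toLinearMap) ?_
  filter_upwards [eventually_surjective hA] with B hB
  have hc : IsClosed (Set.range B) := hB.range_eq ▸ isClosed_univ
  exact continuousAt_enat_of_eventually_le (fun n => eventually_le_nullity hB)
    (eventually_nullity_le hc)

theorem eventually_nullity_add_deficiency_eq_of_nullity_lt_top {A : E →L[𝕜] G}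
    (hc : IsClosed (Set.range A)) (hfin : nullity A.toLinearMap < ⊤) :
    ∀ᶠ B : E →L[𝕜] G in 𝓝 A, nullity B.toLinearMap + deficiency A.toLinearMap =
      nullity A.toLinearMap + deficiency B.toLinearMap := by
  obtain ⟨L, hL, hdef, hinj, hrange⟩ := exists_injective_comp_subtypeL hc hfin
  have := hL.completeSpace_coe
  have hcomp : ∀ B : E →L[𝕜] G, Function.Injective (B ∘L L.subtypeL) →
      nullity B.toLinearMap + deficiency (B ∘L L.subtypeL).toLinearMap =
        nullity A.toLinearMap + deficiency B.toLinearMap := fun B hB => by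
    have hzero : nullity (B.toLinearMap ∘ₗ L.subtype) = 0 := nullity_eq_zero_iff.2 hB
    have hindex := index_comp B.toLinearMap L.subtype
    rwa [nullity_eq_zero_iff.2 L.injective_subtype, zero_add, hdef, hzero, zero_add] at hindex
  have hdefA : deficiency (A ∘L L.subtypeL).toLinearMap = deficiency A.toLinearMap :=
    ENat.add_right_injective_of_ne_top hfin.ne (hcomp A hinj)
  have hcont : Continuous fun B : E →L[𝕜] G => B ∘L L.subtypeL := by fun_prop
  filter_upwards [hcont.tendsto A (eventually_injective_isClosed_range hinj hrange),
    hcont.tendsto A (eventually_deficiency_eq hinj hrange)] with B hB hdefB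
  rw [← hcomp B hB.1, ← hdefA, hdefB]

theorem eventually_nullity_add_deficiency_eq_of_deficiency_lt_top {A : E →L[𝕜] G}
    (hfin : deficiency A.toLinearMap < ⊤) :
    ∀ᶠ B : E →L[𝕜] G in 𝓝 A, nullity B.toLinearMap + deficiency A.toLinearMap =
      nullity A.toLinearMap + deficiency B.toLinearMap := by
  obtain ⟨F, hF, hnull, hsurj⟩ := exists_surjective_mkQL_comp hfin
  have hcomp : ∀ B : E →L[𝕜] G, Function.Surjective (F.mkQL ∘L B) →
      nullity B.toLinearMap + deficiency A.toLinearMap =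
        nullity (F.mkQL ∘L B).toLinearMap + deficiency B.toLinearMap := fun B hB => by
    have hzero : deficiency (F.mkQ ∘ₗ B.toLinearMap) = 0 := deficiency_eq_zero_iff.2 hB
    have hindex := index_comp F.mkQ B.toLinearMap
    rwa [hnull, hzero, add_zero, deficiency_eq_zero_iff.2 F.mkQ_surjective, add_zero] at hindex
  have hnullA : nullity (F.mkQL ∘L A).toLinearMap = nullity A.toLinearMap :=
    ENat.add_left_injective_of_ne_top hfin.ne (hcomp A hsurj).symm
  have hcont : Continuous fun B : E →L[𝕜] G => F.mkQL ∘L B := by fun_prop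
  filter_upwards [hcont.tendsto A (eventually_surjective hsurj),
    hcont.tendsto A (eventually_nullity_eq hsurj)] with B hB hnullB
  rw [hcomp B hB, hnullB, hnullA]

end Perturbation

section Index

variable {X : Type*} [NormedAddCommGroup X] [NormedSpace ℂ X]

theorem alpha_eq_nullity (S : X →L[ℂ] X) : alpha S = nullity S.toLinearMap :=
  (Module.length_eq_rank ℂ _).symm

theorem beta_eq_deficiency (S : X →L[ℂ] X) : beta S = deficiency S.toLinearMap :=
  (Module.length_eq_rank ℂ _).symm

theorem ereal_sub_eq_sub_of_add_eq_add {a b p q : ℕ∞} (h : p + b = a + q)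
    (hfin : a < ⊤ ∧ p < ⊤ ∨ b < ⊤ ∧ q < ⊤) :
    ((p : ENNReal) : EReal) - ((q : ENNReal) : EReal) =
      ((a : ENNReal) : EReal) - ((b : ENNReal) : EReal) := by
  have hnat (a b p q : ℕ) (h : (p : ℕ∞) + b = a + q) :
      (((p : ℕ∞) : ENNReal) : EReal) - (((q : ℕ∞) : ENNReal) : EReal) =
        (((a : ℕ∞) : ENNReal) : EReal) - (((b : ℕ∞) : ENNReal) : EReal) := by
    have hreal : (p : ℝ) - q = a - b := by
      rw [sub_eq_sub_iff_add_eq_add]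
      exact_mod_cast h
    exact congrArg Real.toEReal hreal
  have htop (m n : ℕ) : (⊤ : ℕ∞) ≠ m + n := by exact_mod_cast ENat.top_ne_natCast (m + n)
  cases a <;> cases b <;> cases p <;> cases q <;>
    first | exact hnat _ _ _ _ h | simp [htop] at h hfin ⊢

theorem IsSemiFredholm.eventually_index_eq [CompleteSpace X] {S : X →L[ℂ] X}
    (hS : IsSemiFredholm S) : ∀ᶠ B in 𝓝 S, index B = index S := by
  simp only [IsSemiFredholm, IsUpperSemiFredholm, IsLowerSemiFredholm, alpha_eq_nullity,
    beta_eq_deficiency] at hS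
  simp only [index, alpha_eq_nullity, beta_eq_deficiency]
  rcases hS with ⟨hc, hfin⟩ | ⟨-, hfin⟩
  · filter_upwards [eventually_nullity_le hc hfin,
      eventually_nullity_add_deficiency_eq_of_nullity_lt_top hc hfin] with B hle heq
    exact ereal_sub_eq_sub_of_add_eq_add heq (.inl ⟨hfin, hle.trans_lt hfin⟩)
  · filter_upwards [eventually_deficiency_le hfin,
      eventually_nullity_add_deficiency_eq_of_deficiency_lt_top hfin] with B hle heq
    exact ereal_sub_eq_sub_of_add_eq_add heq (.inr ⟨hfin, hle.trans_lt hfin⟩)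

theorem IsSemiFredholm.eventually_index_sub_smul_eq [CompleteSpace X] {S : X →L[ℂ] X}
    (hS : IsSemiFredholm S) : ∀ᶠ z : ℂ in 𝓝 0, index (S - z • 1) = index S := by
  have hcont : Continuous fun z : ℂ => S - z • (1 : X →L[ℂ] X) := by fun_prop
  exact (hcont.tendsto' 0 S (by simp)).eventually hS.eventually_index_eq

end Index

section Resolvent

variable {X Y : Type*} [NormedAddCommGroup X] [NormedSpace ℂ X] [NormedAddCommGroup Y]
  [NormedSpace ℂ Y]

theorem IsZeroloid.eventually_notMem {S : X →L[ℂ] X} (hS : IsZeroloid S) {z : ℂ} (hz : z ≠ 0) :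
    ∀ᶠ w in 𝓝[≠] z, w ∉ spectrum ℂ S := by
  have hacc : ¬ AccPt z (𝓟 (spectrum ℂ S)) := fun h => hz (hS h)
  rwa [accPt_iff_frequently_nhdsNE, not_frequently] at hacc

theorem IsZeroloid.frequently_notMem {S : X →L[ℂ] X} {R : Y →L[ℂ] Y} (hS : IsZeroloid S)
    (hR : IsZeroloid R) : ∃ᶠ z in 𝓝 (0 : ℂ), z ∉ spectrum ℂ S ∧ z ∉ spectrum ℂ R := by
  intro hev
  obtain ⟨z, hzev, hz⟩ := ((hev.eventually_nhds.filter_mono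
    (nhdsWithin_le_nhds (s := {0}ᶜ))).and self_mem_nhdsWithin).exists
  obtain ⟨w, hwev, hwS, hwR⟩ := ((hzev.filter_mono (nhdsWithin_le_nhds (s := {z}ᶜ))).and
    ((hS.eventually_notMem hz).and (hR.eventually_notMem hz))).exists
  exact hwev ⟨hwS, hwR⟩

theorem bijective_sub_smul_of_notMem_spectrum {S : X →L[ℂ] X} {z : ℂ} (hz : z ∉ spectrum ℂ S) :
    Function.Bijective (S - z • 1 : X →L[ℂ] X) := by
  rw [spectrum.notMem_iff, Algebra.algebraMap_eq_smul_one, IsUnit.sub_iff] at hz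
  exact (Module.End.isUnit_iff _).1 <|
    hz.map (ContinuousLinearMap.toLinearMapRingHom (R₁ := ℂ) (M₁ := X))

theorem index_restrict_sub_smul_eq {T : X →L[ℂ] X} {M N M' N' : Submodule ℂ X}
    (hTM : Set.MapsTo T M M) (hTN : Set.MapsTo T N N)
    (hTM' : Set.MapsTo T M' M') (hTN' : Set.MapsTo T N' N')
    (hMN : M ⊓ N = ⊥) (hMN' : M' ⊓ N' = ⊥) (hsum : M ⊔ N = M' ⊔ N') {z : ℂ}
    (hz : z ∉ spectrum ℂ (T.restrict hTN)) (hz' : z ∉ spectrum ℂ (T.restrict hTN')) :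
    index (T.restrict hTM - z • 1) = index (T.restrict hTM' - z • 1) := by
  let f : X →ₗ[ℂ] X := T.toLinearMap - z • 1
  have hf {P : Submodule ℂ X} (hP : Set.MapsTo T P P) : ∀ x ∈ P, f x ∈ P :=
    fun _ hx => P.sub_mem (hP hx) (P.smul_mem z hx)
  have hfsum : ∀ x ∈ M ⊔ N, f x ∈ M ⊔ N := fun x hx => by
    obtain ⟨m, hm, n, hn, rfl⟩ := Submodule.mem_sup.1 hx
    rw [map_add]
    exact Submodule.add_mem_sup (hf hTM m hm) (hf hTN n hn)
  have hbij := bijective_sub_smul_of_notMem_spectrum hz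
  have hbij' := bijective_sub_smul_of_notMem_spectrum hz'
  have hnull : nullity (f.restrict (hf hTM)) = nullity (f.restrict (hf hTM')) :=
    (nullity_restrict_eq_of_sup_eq _ (hf hTN) hfsum (disjoint_iff.2 hMN) rfl hbij.1).trans
      (nullity_restrict_eq_of_sup_eq _ (hf hTN') hfsum (disjoint_iff.2 hMN') hsum.symm hbij'.1).symm
  have hdef : deficiency (f.restrict (hf hTM)) = deficiency (f.restrict (hf hTM')) :=
    (deficiency_restrict_eq_of_sup_eq _ (hf hTN) hfsum (disjoint_iff.2 hMN) rfl hbij.2).trans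
      (deficiency_restrict_eq_of_sup_eq _ (hf hTN') hfsum (disjoint_iff.2 hMN') hsum.symm
        hbij'.2).symm
  rw [index, index, alpha_eq_nullity, alpha_eq_nullity, beta_eq_deficiency, beta_eq_deficiency]
  exact congrArg₂ (fun a b : ℕ∞ => ((a : ENNReal) : EReal) - ((b : ENNReal) : EReal)) hnull hdef

end Resolvent

end GzFredholm

theorem lemma3p3_general {X : Type*} [NormedAddCommGroup X] [NormedSpace ℂ X]
    (T : X →L[ℂ] X) (M N M' N' : Submodule ℂ X) [CompleteSpace M] [CompleteSpace M']
    (hTM : Set.MapsTo T M M) (hTN : Set.MapsTo T N N)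
    (hTM' : Set.MapsTo T M' M') (hTN' : Set.MapsTo T N' N')
    (hMN : M ⊓ N = ⊥) (hMN' : M' ⊓ N' = ⊥) (hsum : M ⊔ N = M' ⊔ N')
    (hFM : GzFredholm.IsSemiFredholm (T.restrict hTM))
    (hFM' : GzFredholm.IsSemiFredholm (T.restrict hTM'))
    (hresolvent : ∃ᶠ z in 𝓝 (0 : ℂ),
      z ∉ spectrum ℂ (T.restrict hTN) ∧ z ∉ spectrum ℂ (T.restrict hTN')) :
    GzFredholm.index (T.restrict hTM) = GzFredholm.index (T.restrict hTM') := by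
  obtain ⟨z, ⟨hz, hz'⟩, hindex, hindex'⟩ := (hresolvent.and_eventually
    (hFM.eventually_index_sub_smul_eq.and hFM'.eventually_index_sub_smul_eq)).exists
  rw [← hindex, ← hindex',
    GzFredholm.index_restrict_sub_smul_eq hTM hTN hTM' hTN' hMN hMN' hsum hz hz']

theorem lemma3p3 {X : Type*} [NormedAddCommGroup X] [NormedSpace ℂ X] [CompleteSpace X]
    (T : X →L[ℂ] X) (M N M' N' : Submodule ℂ X)
    (hM : IsClosed (M : Set X)) (hN : IsClosed (N : Set X))
    (hM' : IsClosed (M' : Set X)) (hN' : IsClosed (N' : Set X))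
    (hTM : Set.MapsTo T M M) (hTN : Set.MapsTo T N N)
    (hTM' : Set.MapsTo T M' M') (hTN' : Set.MapsTo T N' N')
    (hMN : M ⊓ N = ⊥) (hMN' : M' ⊓ N' = ⊥)
    (hsum : M ⊔ N = M' ⊔ N') (hclosed : IsClosed ((M ⊔ N : Submodule ℂ X) : Set X))
    (hFM : GzFredholm.IsSemiFredholm (T.restrict hTM))
    (hFM' : GzFredholm.IsSemiFredholm (T.restrict hTM'))
    (hZN : GzFredholm.IsZeroloid (T.restrict hTN))
    (hZN' : GzFredholm.IsZeroloid (T.restrict hTN')) :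
    GzFredholm.index (T.restrict hTM) = GzFredholm.index (T.restrict hTM') := by
  have := hM.completeSpace_coe
  have := hM'.completeSpace_coe
  exact lemma3p3_general T M N M' N' hTM hTN hTM' hTN' hMN hMN' hsum hFM hFM'
    (hZN.frequently_notMem hZN')
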